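/- Let $N\ge 1$ be the number of agents and $\mathcal V=\{1,\dots,N\}$. Let $\mathcal F$ be a family of undirected graphs without self-loops on $\mathcal V$. The Laplacian $L(\mathcal G)=[l_{ij}]$ of a directed graph has, for $i\ne j$, $l_{ij}=-1$ if $(j,i)$ is an edge (agent $i$ receives from agent $j$) and $l_{ij}=0$ otherwise, and $l_{ii}=-\sum_{l\neq i} l_{il}$. Assume that there are constants $0<\underline\lambda\le\bar\lambda$ such that for every $\mathcal G\in\mathcal F$ the Laplacian eigenvalues $0=\lambda_1\le\lambda_2\le\dots\le\lambda_N$ satisfy $\underline\lambda\le\lambda_i\le\bar\lambda$ for $2\le i\le N$. Let $\mathcal E^0$ be the union of the edge sets of the graphs in $\mathcal F$, let $p\in[0,1]$, and for $k\ge 0$ and $(j,i)\in\mathcal E^0$ let $\alpha_k^{ij}$ be random variables with $\mathbb P(\alpha_k^{ij}=1)=p$ and $\mathbb P(\alpha_k^{ij}=0)=1-p$ such that the families $(\alpha_k^{ij})_{(j,i)\in\mathcal E^0}$, $k=0,1,2,\dots$, are mutually independent, and $\alpha_k^{ij}$, $\alpha_k^{rs}$ are independent whenever $(r,s)\notin\{(i,j),(j,i)\}$.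 Given a deterministic switching sequence $\nu=(\mathcal G_0,\mathcal G_1,\dots)$ in $\mathcal F$, let $L_k=L(\mathcal G_k)$, and let $\tilde L_k$ be the Laplacian of the directed graph whose edges are the edges $(j,i)$ of $\mathcal G_k$ with $\alpha_k^{ij}=1$. Consider the system $P$ $$\xi_{k+1}=A_k\xi_k+B_kw_k,\qquad z_k=C_k\xi_k+D_kw_k,$$ with $A_k=I_N\otimes A^d+\tilde L_k\otimes A^c+L_k\otimes A^p$, and $B_k,C_k,D_k$ formed in the same way from real matrices $B^d,B^c,B^p$, $C^d,C^c,C^p$, $D^d,D^c,D^p$ (agent dimensions $n_\xi$, $n_w$, $n_z$). $P$ is called mean-square stable if, for $w=0$, $\lim_{k\to\infty}\mathbb E\|\xi_k\|^2=0$ for all initial states $\xi_0$ and all switching sequences $\nu$ in $\mathcal F$, and also if the graph of active edges at time $0$ is drawn instead from an arbitrary distribution on the subgraphs of the graphs in $\mathcal F$, independently of the losses at times $k\ge1$. Its $H_2$-norm is given by $$\|P\|_{H_2}^2=\sup_\nu\sum_{s=1}^{Nn_w}\sum_{k=0}^\infty\mathbb E\|z_k^{\nu,s}\|^2,$$ where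 $z^{\nu,s}$ is the output for $\xi_0=0$, switching sequence $\nu$, and a discrete unit impulse at time $0$ in the $s$-th input. For real $\lambda$ put $\bar p_\lambda=2p(1-p)\lambda$ and $\bar A_\lambda=A^d+\lambda(pA^c+A^p)$, and likewise $\bar B_\lambda,\bar C_\lambda,\bar D_\lambda$. Let $\beta,\gamma\in\mathbb R$. Suppose there are $Q\succ0$ in $\mathbb R^{n_\xi\times n_\xi}$ and symmetric $Z_1,Z_2\in\mathbb R^{n_w\times n_w}$ with $\operatorname{tr}Z_1<\gamma^2$ and $\operatorname{tr}Z_2<\beta^2$ such that, for $\lambda\in\{\underline\lambda,\bar\lambda\}$, $$\bar A_\lambda^TQ\bar A_\lambda+\bar C_\lambda^T\bar C_\lambda+\bar p_\lambda\big((A^c)^TQA^c+(C^c)^TC^c\big)\prec Q,$$ $$\bar B_\lambda^TQ\bar B_\lambda+\bar D_\lambda^T\bar D_\lambda+\bar p_\lambda\big((B^c)^TQB^c+(D^c)^TD^c\big)\prec Z_1,$$ $$(A^d)^TQA^d+(C^d)^TC^d\prec Q,\qquad (B^d)^TQB^d+(D^d)^TD^d\prec Z_2.$$ Then $P$ is mean-square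 stable and $\|P\|_{H_2}^2<\beta^2+(N-1)\gamma^2$. -/

import Mathlib

open MeasureTheory ProbabilityTheory Filter Topology
open scoped ENNReal Matrix Kronecker

noncomputable section

namespace SwitchedMAS

/-! ### Graphs and Laplacians

A directed edge is a pair `(j, i)`; it is read as "agent `i` receives information from agent `j`".
-/

/-- The set of directed edges of an undirected graph without self-loops. -/
def edges {N : ℕ} (G : SimpleGraph (Fin N)) : Set (Fin N × Fin N) :=
  {e | G.Adj e.1 e.2}

theorem mem_edges {N : ℕ} (G : SimpleGraph (Fin N)) (j i : Fin N) :
    (j, i) ∈ edges G ↔ G.Adj j i := Iff.rfl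

open Classical in
/-- The Laplacian of the directed graph with edge set `E`: for `i ≠ j`, the entry `(i, j)` is `-1`
if `(j, i)` is an edge and `0` otherwise; diagonal entries make the row sums vanish. -/
def laplacian {N : ℕ} (E : Set (Fin N × Fin N)) : Matrix (Fin N) (Fin N) ℝ :=
  Matrix.of fun i j =>
    if i = j then ∑ l ∈ Finset.univ.filter (fun l => l ≠ i), (if (l, i) ∈ E then 1 else 0)
    else if (j, i) ∈ E then -1 else 0

open Classical in
/-- On undirected graphs this is Mathlib's Laplacian. -/
theorem laplacian_edges {N : ℕ} (G : SimpleGraph (Fin N)) :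
    laplacian (edges G) = G.lapMatrix ℝ := by
  ext i j
  by_cases h : i = j
  · subst h
    have h1 : (∑ l ∈ Finset.univ.filter (fun l => l ≠ i), (if G.Adj l i then (1 : ℝ) else 0))
        = ∑ l, (if G.Adj i l then (1 : ℝ) else 0) := by
      rw [Finset.sum_filter]
      refine Finset.sum_congr rfl fun l _ => ?_
      by_cases hl : l = i
      · subst hl; simp
      · simp [hl, G.adj_comm]
    simp only [laplacian, mem_edges, Matrix.of_apply, if_true]
    rw [h1]
    simp [SimpleGraph.lapMatrix, SimpleGraph.degMatrix, SimpleGraph.degree,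
      SimpleGraph.neighborFinset_eq_filter]
  · simp only [laplacian, mem_edges, Matrix.of_apply, if_neg h,
      SimpleGraph.lapMatrix, SimpleGraph.degMatrix, Matrix.sub_apply, Matrix.diagonal_apply,
      SimpleGraph.adjMatrix_apply, G.adj_comm j i]
    split_ifs <;> simp

theorem laplacian_edges_isHermitian {N : ℕ} (G : SimpleGraph (Fin N)) :
    (laplacian (edges G)).IsHermitian := by
  classical
  rw [laplacian_edges]
  exact (SimpleGraph.posSemidef_lapMatrix ℝ G).isHermitian

/-- All Laplacian eigenvalues of the undirected graph `G`, counted with multiplicity and with the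
exception of the smallest one, lie in `[lo, hi]`.  (`eigenvalues₀` lists the eigenvalues in
decreasing order, so the smallest one, which is `0`, is the last one.) -/
def EigenvaluesIn {N : ℕ} (lo hi : ℝ) (G : SimpleGraph (Fin N)) : Prop :=
  ∀ i : Fin (Fintype.card (Fin N)), (i : ℕ) + 1 < N →
    lo ≤ (laplacian_edges_isHermitian G).eigenvalues₀ i ∧
      (laplacian_edges_isHermitian G).eigenvalues₀ i ≤ hi

/-- The union of the edge sets of all admissible graphs. -/
def unionEdges {N : ℕ} (F : Set (SimpleGraph (Fin N))) : Set (Fin N × Fin N) :=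
  ⋃ G ∈ F, edges G

/-- The edge sets that can arise from an admissible graph by losing packets. -/
def lossyFamily {N : ℕ} (F : Set (SimpleGraph (Fin N))) : Set (Set (Fin N × Fin N)) :=
  {E | ∃ G ∈ F, E ⊆ edges G}

/-! ### Packet loss -/

/-- Bernoulli packet loss with transmission probability `p`: `α k (j, i)` is `true` if the
transmission from `j` to `i` at time `k` succeeds.  Losses are independent in time, and losses on
two links that join different pairs of agents are independent; nothing is required of the
joint law of `α k (j, i)` and `α k (i, j)`.  Only the edges in `E₀` matter. -/
structure BernoulliLoss {N : ℕ} {Ω : Type*} [MeasurableSpace Ω] (P : Measure Ω)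
    (E₀ : Set (Fin N × Fin N)) (p : ℝ) (α : ℕ → Fin N × Fin N → Ω → Bool) : Prop where
  measurable : ∀ k, ∀ e ∈ E₀, Measurable (α k e)
  prob_one : ∀ k, ∀ e ∈ E₀, P {ω | α k e ω = true} = ENNReal.ofReal p
  prob_zero : ∀ k, ∀ e ∈ E₀, P {ω | α k e ω = false} = ENNReal.ofReal (1 - p)
  indep_links : ∀ k, ∀ e ∈ E₀, ∀ e' ∈ E₀, e' ≠ e → e' ≠ e.swap → IndepFun (α k e) (α k e') P
  indep_time : iIndepFun (fun (k : ℕ) (ω : Ω) (e : E₀) => α k e ω) P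

/-- The random edge set that is active at time `k` if the nominal graph at time `k` is `ν k`. -/
def activeEdges {N : ℕ} {Ω : Type*} (ν : ℕ → SimpleGraph (Fin N))
    (α : ℕ → Fin N × Fin N → Ω → Bool) (ω : Ω) (k : ℕ) : Set (Fin N × Fin N) :=
  {e | e ∈ edges (ν k) ∧ α k e ω = true}

/-! ### The switched system -/

/-- The three agent-sized parts (decoupled, stochastically coupled, deterministically coupled) of a
decomposable matrix. -/
structure DecompMatrix (m n : ℕ) where
  d : Matrix (Fin m) (Fin n) ℝ
  c : Matrix (Fin m) (Fin n) ℝ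
  p : Matrix (Fin m) (Fin n) ℝ

/-- `I ⊗ Mᵈ + L(E) ⊗ Mᶜ + L(G) ⊗ Mᵖ`, for the active edge set `E` and the nominal graph `G`. -/
def DecompMatrix.full {m n N : ℕ} (M : DecompMatrix m n)
    (E : Set (Fin N × Fin N)) (G : SimpleGraph (Fin N)) :
    Matrix (Fin N × Fin m) (Fin N × Fin n) ℝ :=
  (1 : Matrix (Fin N) (Fin N) ℝ) ⊗ₖ M.d + laplacian E ⊗ₖ M.c + laplacian (edges G) ⊗ₖ M.p

/-- `Mᵈ + lam (p Mᶜ + Mᵖ)`. -/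
def DecompMatrix.bar {m n : ℕ} (M : DecompMatrix m n) (p lam : ℝ) :
    Matrix (Fin m) (Fin n) ℝ :=
  M.d + lam • (p • M.c + M.p)

/-- The data of a homogeneous multi-agent system: per-agent state, input and output dimensions
`nx`, `nw`, `nz`. -/
structure System (nx nw nz : ℕ) where
  A : DecompMatrix nx nx
  B : DecompMatrix nx nw
  C : DecompMatrix nz nx
  D : DecompMatrix nz nw

/-- The squared Euclidean norm `xᵀ x`. -/
def normSq {ι : Type*} [Fintype ι] (x : ι → ℝ) : ℝ := x ⬝ᵥ x

/-- The state at time `k` of the system with graph sequence `ν`, sequence of active edge sets `σ`,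
input `w` and initial state `ξ₀`. -/
def System.state {nx nw nz N : ℕ} (S : System nx nw nz) (ν : ℕ → SimpleGraph (Fin N))
    (σ : ℕ → Set (Fin N × Fin N)) (w : ℕ → Fin N × Fin nw → ℝ) (ξ₀ : Fin N × Fin nx → ℝ) :
    ℕ → Fin N × Fin nx → ℝ
  | 0 => ξ₀
  | k + 1 => S.A.full (σ k) (ν k) *ᵥ S.state ν σ w ξ₀ k + S.B.full (σ k) (ν k) *ᵥ w k

/-- The output at time `k`. -/
def System.output {nx nw nz N : ℕ} (S : System nx nw nz) (ν : ℕ → SimpleGraph (Fin N))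
    (σ : ℕ → Set (Fin N × Fin N)) (w : ℕ → Fin N × Fin nw → ℝ) (ξ₀ : Fin N × Fin nx → ℝ)
    (k : ℕ) : Fin N × Fin nz → ℝ :=
  S.C.full (σ k) (ν k) *ᵥ S.state ν σ w ξ₀ k + S.D.full (σ k) (ν k) *ᵥ w k

/-- Mean-square stability: with zero input, `E ‖ξ_k‖² → 0` for all initial states and all switching
sequences in `F`, both for the given packet loss process and when the active edge set at time `0`
is redrawn, independently of the losses at later times, from an arbitrary distribution `π₀`. -/
def System.MeanSquareStable {nx nw nz N : ℕ} (S : System nx nw nz) (F : Set (SimpleGraph (Fin N)))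
    {Ω : Type*} [MeasurableSpace Ω] (P : Measure Ω) (α : ℕ → Fin N × Fin N → Ω → Bool) : Prop :=
  ∀ (ξ₀ : Fin N × Fin nx → ℝ) (ν : ℕ → SimpleGraph (Fin N)), (∀ k, ν k ∈ F) →
    Tendsto (fun k => ∫⁻ ω, ENNReal.ofReal
      (normSq (S.state ν (activeEdges ν α ω) 0 ξ₀ k)) ∂P) atTop (𝓝 0) ∧
    ∀ π₀ : PMF (lossyFamily F),
      Tendsto (fun k => ∑' E : lossyFamily F, π₀ E * ∫⁻ ω, ENNReal.ofReal
        (normSq (S.state ν (Function.update (activeEdges ν α ω) 0 (E : Set (Fin N × Fin N)))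
          0 ξ₀ k)) ∂P) atTop (𝓝 0)

/-- The discrete unit impulse in the `s`-th input channel. -/
def impulse {ι : Type*} [DecidableEq ι] (s : ι) : ℕ → ι → ℝ :=
  fun k => if k = 0 then Pi.single s 1 else 0

/-- The squared `H₂`-norm: the supremum over all switching sequences of the sum over all input
channels of the mean output energy of the impulse response. -/
def System.h2NormSq {nx nw nz N : ℕ} (S : System nx nw nz) (F : Set (SimpleGraph (Fin N)))
    {Ω : Type*} [MeasurableSpace Ω] (P : Measure Ω) (α : ℕ → Fin N × Fin N → Ω → Bool) : ℝ≥0∞ :=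
  ⨆ (ν : ℕ → SimpleGraph (Fin N)) (_ : ∀ k, ν k ∈ F),
    ∑ s : Fin N × Fin nw, ∑' k : ℕ, ∫⁻ ω, ENNReal.ofReal
      (normSq (S.output ν (activeEdges ν α ω) (impulse s) 0 k)) ∂P

end SwitchedMAS

end

/-!
The storage function `V(ξ) = ξᵀ (I ⊗ Q) ξ` certifies both claims.

For a fixed vector `x`, the mean of `V (A_k x) + ‖C_k x‖²` over the losses at time `k` is computed
exactly (`BernoulliLoss.integral_blockQuad`). Agent `i` sees the sum of `α^{ij} Mᶜ (xᵢ - xⱼ)` over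
its neighbours `j`, and the losses on the links into one agent are pairwise independent. So only the
mean `p L` of the random Laplacian and the variances `p (1 - p)` enter; the correlation of a link
with its reversal does not, because the two lead to different agents. The variances contribute
the Dirichlet form of the undirected graph, which counts each edge twice. Both terms become
diagonal in an orthonormal eigenbasis of `L`, and the mean is the sum of `modeCost` over the
eigenvalues (`BernoulliLoss.lintegral_step`).

The linear matrix inequalities bound `modeCost` at `0`, `lo` and `hi`. As `modeCost` is
convex in the eigenvalue (`modeCost_le_of_endpoints`), it is bounded at every eigenvalue of every
admissible graph. In the state this gives a contraction factor `ρ < 1` that is uniform over the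
graphs (`BernoulliLoss.exists_contraction`). In the input, an impulse injects, summed over the
channels, at most `tr Z₂ + (N - 1) tr Z₁` (`BernoulliLoss.sum_impulse_le`), the eigenvalue `0` being
simple.

The losses at time `k` are independent of the state at time `k`, so the one-step bounds
propagate along trajectories (`BernoulliLoss.lintegral_le`): the mean of `V` decays
geometrically, and the output energy telescopes against it. The law of the active edges at time `0`
is irrelevant for the decay, as only the state at time `1` has to have finite mean storage.
-/

namespace SwitchedMAS

/-! ### Quadratic forms -/

/-- The quadratic form `xᵀ W x`. -/
def quad {m : ℕ} (W : Matrix (Fin m) (Fin m) ℝ) (x : Fin m → ℝ) : ℝ := x ⬝ᵥ W *ᵥ x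

theorem quad_zero {m : ℕ} (W : Matrix (Fin m) (Fin m) ℝ) : quad W 0 = 0 := by simp [quad]

theorem quad_smul {m : ℕ} (W : Matrix (Fin m) (Fin m) ℝ) (c : ℝ) (x : Fin m → ℝ) :
    quad W (c • x) = c ^ 2 * quad W x := by
  simp [quad, Matrix.mulVec_smul]; ring

theorem quad_nonneg {m : ℕ} {W : Matrix (Fin m) (Fin m) ℝ} (hW : W.PosSemidef) (x : Fin m → ℝ) :
    0 ≤ quad W x := by
  simpa [quad] using hW.dotProduct_mulVec_nonneg x

theorem quad_pos {m : ℕ} {W : Matrix (Fin m) (Fin m) ℝ} (hW : W.PosDef) {x : Fin m → ℝ}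
    (hx : x ≠ 0) : 0 < quad W x := by
  simpa [quad] using hW.dotProduct_mulVec_pos hx

theorem continuous_quad {m : ℕ} (W : Matrix (Fin m) (Fin m) ℝ) : Continuous (quad W) := by
  unfold quad
  fun_prop

theorem quad_single {m : ℕ} (W : Matrix (Fin m) (Fin m) ℝ) (a : Fin m) :
    quad W (Pi.single a 1) = W a a := by
  simp [quad]

/-- Congruence transforms of the weight: `xᵀ (Mᵀ W M) x = (M x)ᵀ W (M x)`. -/
theorem quad_conj {m n : ℕ} (W : Matrix (Fin m) (Fin m) ℝ) (M : Matrix (Fin m) (Fin n) ℝ)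
    (x : Fin n → ℝ) : quad (Mᵀ * W * M) x = quad W (M *ᵥ x) := by
  simp only [quad, ← Matrix.mulVec_mulVec, Matrix.dotProduct_mulVec, Matrix.vecMul_transpose]

theorem quad_gram {m n : ℕ} (M : Matrix (Fin m) (Fin n) ℝ) (x : Fin n → ℝ) :
    quad (Mᵀ * M) x = quad 1 (M *ᵥ x) := by
  rw [← quad_conj, Matrix.mul_one]

theorem quad_add_weight {m : ℕ} (V W : Matrix (Fin m) (Fin m) ℝ) (x : Fin m → ℝ) :
    quad (V + W) x = quad V x + quad W x := by
  simp [quad, Matrix.add_mulVec]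

theorem quad_sub_weight {m : ℕ} (V W : Matrix (Fin m) (Fin m) ℝ) (x : Fin m → ℝ) :
    quad (V - W) x = quad V x - quad W x := by
  simp [quad, Matrix.sub_mulVec]

theorem quad_smul_weight {m : ℕ} (c : ℝ) (W : Matrix (Fin m) (Fin m) ℝ) (x : Fin m → ℝ) :
    quad (c • W) x = c * quad W x := by
  simp [quad, Matrix.smul_mulVec]

theorem quad_bilin {m : ℕ} (W : Matrix (Fin m) (Fin m) ℝ) (x : Fin m → ℝ) :
    quad W x = Matrix.toBilin' W x x := by
  simp [quad, Matrix.toBilin'_apply']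

theorem quad_add {m : ℕ} (W : Matrix (Fin m) (Fin m) ℝ) (x y : Fin m → ℝ) :
    quad W (x + y) = quad W x + (Matrix.toBilin' W x y + Matrix.toBilin' W y x) + quad W y := by
  simp only [quad_bilin, map_add, LinearMap.add_apply]; ring

/-- Every quadratic form is dominated by every positive definite one, up to a constant. -/
theorem exists_pos_mul_quad_le {m : ℕ} {R : Matrix (Fin m) (Fin m) ℝ} (hR : R.PosDef)
    (Q : Matrix (Fin m) (Fin m) ℝ) : ∃ ε : ℝ, 0 < ε ∧ ∀ x, ε * quad Q x ≤ quad R x := by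
  obtain rfl | hm := Nat.eq_zero_or_pos m
  · exact ⟨1, one_pos, fun x => by simp [Subsingleton.elim x 0, quad, dotProduct]⟩
  have : Nonempty (Fin m) := ⟨⟨0, hm⟩⟩
  have hK : IsCompact (Metric.sphere (0 : Fin m → ℝ) 1) := isCompact_sphere _ _
  have hne : (Metric.sphere (0 : Fin m → ℝ) 1).Nonempty := NormedSpace.sphere_nonempty.2 zero_le_one
  obtain ⟨x₀, hx₀, hmin⟩ := hK.exists_isMinOn hne (continuous_quad R).continuousOn
  obtain ⟨x₁, hx₁, hmax⟩ := hK.exists_isMaxOn hne (continuous_quad Q).continuousOn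
  have hx0 : x₀ ≠ 0 := by
    rintro rfl
    simp at hx₀
  have hpos := quad_pos hR hx0
  set C : ℝ := max (quad Q x₁) 1
  have hC : 0 < C := lt_of_lt_of_le one_pos (le_max_right _ _)
  refine ⟨quad R x₀ / C, by positivity, fun x => ?_⟩
  by_cases hx : x = 0
  · simp [hx, quad_zero]
  have hn : 0 < ‖x‖ := norm_pos_iff.2 hx
  have hy : ‖x‖⁻¹ • x ∈ Metric.sphere (0 : Fin m → ℝ) 1 := by
    simp [norm_smul, hn.ne']
  have h1 : quad R x₀ ≤ quad R (‖x‖⁻¹ • x) := hmin hy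
  have h2 : quad Q (‖x‖⁻¹ • x) ≤ C := (hmax hy).trans (le_max_left _ _)
  rw [quad_smul] at h1 h2
  have hs : 0 < ‖x‖⁻¹ ^ 2 := by positivity
  rw [div_mul_eq_mul_div, div_le_iff₀ hC]
  refine le_of_mul_le_mul_left ?_ hs
  calc ‖x‖⁻¹ ^ 2 * (quad R x₀ * quad Q x) = quad R x₀ * (‖x‖⁻¹ ^ 2 * quad Q x) := by ring
    _ ≤ quad R x₀ * C := by gcongr
    _ ≤ (‖x‖⁻¹ ^ 2 * quad R x) * C := by gcongr
    _ = _ := by ring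

/-- `λ ↦ q(a + λ b) + λ s` is convex for a positive semidefinite form `q`: its values on an
interval are bounded by a common bound at the end points. -/
theorem quad_add_smul_le_of_endpoints {m n : ℕ} {V : Matrix (Fin m) (Fin m) ℝ}
    {W : Matrix (Fin n) (Fin n) ℝ}
    (hV : V.PosSemidef) (hW : W.PosSemidef) (a b : Fin m → ℝ) (c d : Fin n → ℝ) (s T : ℝ)
    {lo hi lam : ℝ} (h₁ : lo ≤ lam) (h₂ : lam ≤ hi)
    (hlo : quad V (a + lo • b) + quad W (c + lo • d) + lo * s ≤ T)
    (hhi : quad V (a + hi • b) + quad W (c + hi • d) + hi * s ≤ T) :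
    quad V (a + lam • b) + quad W (c + lam • d) + lam * s ≤ T := by
  have hb := quad_nonneg hV b
  have hd := quad_nonneg hW d
  simp only [quad_add, quad_smul, map_smul, LinearMap.smul_apply, smul_eq_mul] at hlo hhi ⊢
  rcases h₁.eq_or_lt with rfl | h₁
  · exact hlo
  have hlt : 0 < hi - lo := by linarith
  refine le_of_mul_le_mul_left ?_ hlt
  have e₁ := mul_le_mul_of_nonneg_left hlo (sub_nonneg.2 h₂)
  have e₂ := mul_le_mul_of_nonneg_left hhi (sub_nonneg.2 h₁.le)
  have e₃ : 0 ≤ (quad V b + quad W d) * ((lam - lo) * (hi - lam) * (hi - lo)) :=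
    mul_nonneg (by linarith) (mul_nonneg (mul_nonneg (by linarith) (by linarith)) hlt.le)
  linarith

/-! ### Block vectors -/

/-- The part of a stacked vector that belongs to agent `i`. -/
def blk {N m : ℕ} (x : Fin N × Fin m → ℝ) (i : Fin N) : Fin m → ℝ := fun a => x (i, a)

/-- The quadratic form `xᵀ (I ⊗ W) x`. -/
def blockQuad {N m : ℕ} (W : Matrix (Fin m) (Fin m) ℝ) (x : Fin N × Fin m → ℝ) : ℝ :=
  ∑ i, quad W (blk x i)

theorem blockQuad_nonneg {N m : ℕ} {W : Matrix (Fin m) (Fin m) ℝ} (hW : W.PosSemidef)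
    (x : Fin N × Fin m → ℝ) : 0 ≤ blockQuad W x :=
  Finset.sum_nonneg fun _ _ => quad_nonneg hW _

theorem blockQuad_one {N m : ℕ} (x : Fin N × Fin m → ℝ) : blockQuad 1 x = normSq x := by
  simp [blockQuad, quad, normSq, dotProduct, blk, Fintype.sum_prod_type]

open Classical in
/-- The sum over the in-neighbours `j` of `i` of the relative values `v i - v j`. -/
theorem sum_laplacian_smul {N m : ℕ} (E : Set (Fin N × Fin N)) (v : Fin N → Fin m → ℝ) (i : Fin N) :
    ∑ j, laplacian E i j • v j = ∑ j, (if (j, i) ∈ E then (1 : ℝ) else 0) • (v i - v j) := by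
  have h : ∀ j, laplacian E i j = (if j = i then ∑ l, (if (l, i) ∈ E then (1 : ℝ) else 0) else 0)
      - (if (j, i) ∈ E then 1 else 0) := by
    intro j
    by_cases hij : j = i
    · subst hij
      simp only [laplacian, Matrix.of_apply, if_true]
      rw [Finset.filter_ne', ← Finset.sum_erase_add _ _ (Finset.mem_univ j)]
      ring
    · simp only [laplacian, Matrix.of_apply, if_neg hij, if_neg (Ne.symm hij)]
      split_ifs <;> simp
  simp only [h, sub_smul, Finset.sum_sub_distrib, smul_sub, ite_smul, zero_smul,
    Finset.sum_ite_eq', Finset.mem_univ, if_true, Finset.sum_smul]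

theorem blk_kronecker_mulVec {N m n : ℕ} (L : Matrix (Fin N) (Fin N) ℝ)
    (M : Matrix (Fin m) (Fin n) ℝ) (x : Fin N × Fin n → ℝ) (i : Fin N) :
    blk ((L ⊗ₖ M) *ᵥ x) i = M *ᵥ ∑ j, L i j • blk x j := by
  ext a
  simp only [blk, Matrix.mulVec, dotProduct, Fintype.sum_prod_type, Matrix.kroneckerMap_apply,
    Finset.sum_apply, Pi.smul_apply, smul_eq_mul, Finset.mul_sum]
  rw [Finset.sum_comm]
  exact Finset.sum_congr rfl fun _ _ => Finset.sum_congr rfl fun _ _ => by ring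

open Classical in
/-- The dynamics seen by a single agent. -/
theorem blk_full_mulVec {N m n : ℕ} (M : DecompMatrix m n) (E : Set (Fin N × Fin N))
    (G : SimpleGraph (Fin N)) (x : Fin N × Fin n → ℝ) (i : Fin N) :
    blk (M.full E G *ᵥ x) i = M.d *ᵥ blk x i
      + M.p *ᵥ ∑ j, laplacian (edges G) i j • blk x j
      + ∑ j, (if (j, i) ∈ E then (1 : ℝ) else 0) • M.c *ᵥ (blk x i - blk x j) := by
  have h : ∀ y z : Fin N × Fin m → ℝ, blk (y + z) i = blk y i + blk z i := fun _ _ => rfl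
  simp only [DecompMatrix.full, Matrix.add_mulVec, h, blk_kronecker_mulVec]
  have h1 : ∑ j, (1 : Matrix (Fin N) (Fin N) ℝ) i j • blk x j = blk x i := by
    simp [Matrix.one_apply]
  rw [sum_laplacian_smul E, h1, add_right_comm]
  congr 1
  simp only [Matrix.mulVec_sum, Matrix.mulVec_smul]

/-! ### The spectrum of the Laplacian -/

/-- An orthogonal diagonalisation of the Laplacian of `G`: the columns of `U` are orthonormal
eigenvectors for the eigenvalues `lam`. -/
structure Diagonalises {N : ℕ} (G : SimpleGraph (Fin N)) (U : Matrix (Fin N) (Fin N) ℝ)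
    (lam : Fin N → ℝ) : Prop where
  mul_transpose : U * Uᵀ = 1
  laplacian_mul : laplacian (edges G) * U = U * Matrix.diagonal lam

theorem laplacian_edges_isSymm {N : ℕ} (G : SimpleGraph (Fin N)) (i j : Fin N) :
    laplacian (edges G) i j = laplacian (edges G) j i := by
  simpa using (laplacian_edges_isHermitian G).apply j i

/-- If all but the smallest eigenvalue lie in `[lo, hi]` with `lo > 0`, the remaining one is a
simple eigenvalue `0`, since the Laplacian is singular. -/
theorem EigenvaluesIn.exists_diagonalises {N : ℕ} (hN : 1 ≤ N) {lo hi : ℝ} (hlo : 0 < lo)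
    {G : SimpleGraph (Fin N)} (hG : EigenvaluesIn lo hi G) :
    ∃ U lam, Diagonalises G U lam ∧ ∃ r₀, lam r₀ = 0 ∧ ∀ r ≠ r₀, lo ≤ lam r ∧ lam r ≤ hi := by
  classical
  have : Nonempty (Fin N) := ⟨⟨0, hN⟩⟩
  have hL := laplacian_edges_isHermitian G
  refine ⟨hL.eigenvectorUnitary, hL.eigenvalues, ⟨?_, ?_⟩, ?_⟩
  · have := Matrix.mem_unitaryGroup_iff.1 hL.eigenvectorUnitary.2
    rwa [Matrix.star_eq_conjTranspose, Matrix.conjTranspose_eq_transpose_of_trivial] at this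
  · ext i r
    have := congrFun (hL.mulVec_eigenvectorBasis r) i
    rw [Matrix.mul_diagonal]
    simpa [Matrix.mul_apply, Matrix.mulVec, dotProduct, mul_comm] using this
  · have hdet : (laplacian (edges G)).det = 0 := by
      rw [laplacian_edges]; exact G.det_lapMatrix_eq_zero
    rw [hL.det_eq_prod_eigenvalues, Finset.prod_eq_zero_iff] at hdet
    obtain ⟨r₀, -, h₀⟩ := hdet
    have h₀ : hL.eigenvalues r₀ = 0 := by simpa using h₀
    let e : Fin (Fintype.card (Fin N)) ≃ Fin N :=
      Fintype.equivOfCardEq (Fintype.card_fin _)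
    have hbd : ∀ r, (e.symm r : ℕ) + 1 < N → lo ≤ hL.eigenvalues r ∧ hL.eigenvalues r ≤ hi :=
      fun r hr => hG (e.symm r) hr
    have hlt : ∀ r, (e.symm r : ℕ) < N := fun r => by simpa using (e.symm r).2
    refine ⟨r₀, h₀, fun r hr => hbd r ?_⟩
    have h1 : ¬ (e.symm r₀ : ℕ) + 1 < N := fun h => by linarith [(hbd r₀ h).1]
    have h2 : (e.symm r : ℕ) ≠ e.symm r₀ := fun h => hr (e.symm.injective (Fin.ext h))
    have := hlt r
    have := hlt r₀
    omega

/-- The coordinates of a family of vectors in the eigenbasis: `v̂_r = ∑ᵢ U i r • vᵢ`. -/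
def modal {N m : ℕ} (U : Matrix (Fin N) (Fin N) ℝ) (v : Fin N → Fin m → ℝ) (r : Fin N) :
    Fin m → ℝ := ∑ i, U i r • v i

theorem modal_add {N m : ℕ} (U : Matrix (Fin N) (Fin N) ℝ) (v w : Fin N → Fin m → ℝ) (r : Fin N) :
    modal U (fun i => v i + w i) r = modal U v r + modal U w r := by
  simp [modal, Finset.sum_add_distrib]

theorem modal_mulVec {N m n : ℕ} (U : Matrix (Fin N) (Fin N) ℝ) (M : Matrix (Fin m) (Fin n) ℝ)
    (v : Fin N → Fin n → ℝ) (r : Fin N) :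
    modal U (fun i => M *ᵥ v i) r = M *ᵥ modal U v r := by
  simp [modal, Matrix.mulVec_sum, Matrix.mulVec_smul]

theorem Diagonalises.modal_laplacian {N m : ℕ} {G : SimpleGraph (Fin N)}
    {U : Matrix (Fin N) (Fin N) ℝ} {lam : Fin N → ℝ} (h : Diagonalises G U lam)
    (v : Fin N → Fin m → ℝ) (r : Fin N) :
    modal U (fun i => ∑ j, laplacian (edges G) i j • v j) r = lam r • modal U v r := by
  have hr : ∀ j, ∑ i, laplacian (edges G) j i * U i r = U j r * lam r := fun j => by
    have := congrFun (congrFun h.laplacian_mul j) r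
    rwa [Matrix.mul_diagonal, Matrix.mul_apply] at this
  simp only [modal, Finset.smul_sum, smul_smul]
  rw [Finset.sum_comm]
  refine Finset.sum_congr rfl fun j _ => ?_
  rw [← Finset.sum_smul, mul_comm (lam r), ← hr j]
  congr 1
  exact Finset.sum_congr rfl fun i _ => by rw [laplacian_edges_isSymm G i j, mul_comm]

/-- Parseval's identity. -/
theorem Diagonalises.sum_bilin {N m : ℕ} {G : SimpleGraph (Fin N)}
    {U : Matrix (Fin N) (Fin N) ℝ} {lam : Fin N → ℝ} (h : Diagonalises G U lam)
    (W : Matrix (Fin m) (Fin m) ℝ) (v w : Fin N → Fin m → ℝ) :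
    ∑ r, Matrix.toBilin' W (modal U v r) (modal U w r) = ∑ i, Matrix.toBilin' W (v i) (w i) := by
  have hU : ∀ i j, ∑ r, U i r * U j r = if i = j then 1 else 0 := fun i j => by
    have := congrFun (congrFun h.mul_transpose i) j
    rwa [Matrix.mul_apply, Matrix.one_apply] at this
  have : ∀ r, Matrix.toBilin' W (modal U v r) (modal U w r)
      = ∑ i, ∑ j, (U i r * U j r) * Matrix.toBilin' W (v i) (w j) := fun r => by
    simp only [modal, map_sum, map_smul, LinearMap.sum_apply, LinearMap.smul_apply, smul_eq_mul,
      Finset.mul_sum]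
    rw [Finset.sum_comm]
    exact Finset.sum_congr rfl fun _ _ => Finset.sum_congr rfl fun _ _ => by ring
  simp only [this]
  rw [Finset.sum_comm]
  refine Finset.sum_congr rfl fun i _ => ?_
  rw [Finset.sum_comm]
  simp [← Finset.sum_mul, hU]

theorem Diagonalises.sum_quad {N m : ℕ} {G : SimpleGraph (Fin N)}
    {U : Matrix (Fin N) (Fin N) ℝ} {lam : Fin N → ℝ} (h : Diagonalises G U lam)
    (W : Matrix (Fin m) (Fin m) ℝ) (v : Fin N → Fin m → ℝ) :
    ∑ r, quad W (modal U v r) = ∑ i, quad W (v i) := by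
  simp only [quad_bilin, h.sum_bilin]

open Classical in
/-- The Dirichlet form of `G` in modal coordinates. Every undirected edge contributes twice. -/
theorem Diagonalises.sum_adj_quad_sub {N m : ℕ} {G : SimpleGraph (Fin N)}
    {U : Matrix (Fin N) (Fin N) ℝ} {lam : Fin N → ℝ} (h : Diagonalises G U lam)
    (W : Matrix (Fin m) (Fin m) ℝ) (v : Fin N → Fin m → ℝ) :
    ∑ i, ∑ j, (if G.Adj j i then (1 : ℝ) else 0) * quad W (v i - v j)
      = ∑ r, 2 * lam r * quad W (modal U v r) := by
  have h1 : ∑ r, lam r * quad W (modal U v r)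
      = ∑ i, ∑ j, (if G.Adj j i then (1 : ℝ) else 0) * Matrix.toBilin' W (v i) (v i - v j) := by
    have := h.sum_bilin W v (fun i => ∑ j, laplacian (edges G) i j • v j)
    simp only [h.modal_laplacian, map_smul, smul_eq_mul, ← quad_bilin] at this
    simpa only [sum_laplacian_smul, mem_edges, map_sum, map_smul, smul_eq_mul] using this
  have h2 : ∑ i, ∑ j, (if G.Adj j i then (1 : ℝ) else 0) * Matrix.toBilin' W (v j) (v i - v j)
      = - ∑ i, ∑ j, (if G.Adj j i then (1 : ℝ) else 0) * Matrix.toBilin' W (v i) (v i - v j) := by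
    rw [Finset.sum_comm]
    simp only [← Finset.sum_neg_distrib]
    refine Finset.sum_congr rfl fun i _ => Finset.sum_congr rfl fun j _ => ?_
    rw [G.adj_comm, ← neg_sub (v i) (v j), map_neg]
    ring
  calc _ = ∑ i, ∑ j, (if G.Adj j i then (1 : ℝ) else 0) * Matrix.toBilin' W (v i) (v i - v j)
        - ∑ i, ∑ j, (if G.Adj j i then (1 : ℝ) else 0) * Matrix.toBilin' W (v j) (v i - v j) := by
        simp only [← Finset.sum_sub_distrib]
        refine Finset.sum_congr rfl fun i _ => Finset.sum_congr rfl fun j _ => ?_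
        rw [quad_bilin, ← mul_sub, ← LinearMap.sub_apply, ← map_sub]
    _ = 2 * ∑ r, lam r * quad W (modal U v r) := by rw [h2, h1]; ring
    _ = _ := by rw [Finset.mul_sum]; exact Finset.sum_congr rfl fun _ _ => by ring

/-! ### Second moments under packet loss -/

theorem quad_add_sum_smul {ι : Type*} [Fintype ι] {m : ℕ} (W : Matrix (Fin m) (Fin m) ℝ)
    (c : Fin m → ℝ) (d : ι → Fin m → ℝ) (t : ι → ℝ) :
    quad W (c + ∑ j, t j • d j) = quad W c
      + ∑ j, t j * (Matrix.toBilin' W c (d j) + Matrix.toBilin' W (d j) c)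
      + ∑ j, ∑ l, t j * t l * Matrix.toBilin' W (d j) (d l) := by
  rw [quad_add, quad_bilin W (∑ j, t j • d j)]
  simp only [map_sum, map_smul, LinearMap.sum_apply, LinearMap.smul_apply, smul_eq_mul,
    Finset.mul_sum, mul_add, Finset.sum_add_distrib]
  congr 1
  rw [Finset.sum_comm]
  exact Finset.sum_congr rfl fun _ _ => Finset.sum_congr rfl fun _ _ => by ring

/-- The expectation of a quadratic form in a random combination of fixed vectors whose
coefficients are indicators of events with means `μ j` and diagonal covariance `s`: only
pairwise correlations enter, so pairwise independence of the events suffices. -/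
theorem integral_quad_indicators {ι Ω : Type*} [Fintype ι] [DecidableEq ι] [MeasurableSpace Ω]
    {P : Measure Ω} [IsProbabilityMeasure P] {m : ℕ} (W : Matrix (Fin m) (Fin m) ℝ) (c : Fin m → ℝ)
    (d : ι → Fin m → ℝ) (E : ι → Set Ω) (hE : ∀ j, MeasurableSet (E j)) (μ s : ι → ℝ)
    (h₁ : ∀ j, P.real (E j) = μ j)
    (h₂ : ∀ j l, P.real (E j ∩ E l) = μ j * μ l + if j = l then s j else 0) :
    Integrable (fun ω => quad W (c + ∑ j, (E j).indicator (1 : Ω → ℝ) ω • d j)) P ∧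
    ∫ ω, quad W (c + ∑ j, (E j).indicator (1 : Ω → ℝ) ω • d j) ∂P
      = quad W (c + ∑ j, μ j • d j) + ∑ j, s j * quad W (d j) := by
  have hmul : ∀ j l ω, (E j).indicator (1 : Ω → ℝ) ω * (E l).indicator (1 : Ω → ℝ) ω
      = (E j ∩ E l).indicator (1 : Ω → ℝ) ω := fun j l ω => by
    rw [Set.inter_indicator_one, Pi.mul_apply]
  have hI : ∀ A : Set Ω, MeasurableSet A → Integrable (fun ω => A.indicator (1 : Ω → ℝ) ω) P :=
    fun A hA => (integrable_const (1 : ℝ)).indicator hA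
  have hv : ∀ A : Set Ω, MeasurableSet A → ∫ ω, A.indicator (1 : Ω → ℝ) ω ∂P = P.real A :=
    fun A hA => integral_indicator_one hA
  simp only [quad_add_sum_smul, hmul]
  have i₁ : Integrable (fun ω => ∑ j, (E j).indicator (1 : Ω → ℝ) ω *
      (Matrix.toBilin' W c (d j) + Matrix.toBilin' W (d j) c)) P :=
    integrable_finsetSum _ fun j _ => (hI _ (hE j)).mul_const _
  have i₂' : ∀ j, Integrable (fun ω => ∑ l, (E j ∩ E l).indicator (1 : Ω → ℝ) ω *
      Matrix.toBilin' W (d j) (d l)) P := fun j =>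
    integrable_finsetSum _ fun l _ => (hI _ ((hE j).inter (hE l))).mul_const _
  have i₂ : Integrable (fun ω => ∑ j, ∑ l, (E j ∩ E l).indicator (1 : Ω → ℝ) ω *
      Matrix.toBilin' W (d j) (d l)) P := integrable_finsetSum _ fun j _ => i₂' j
  have i₀ : Integrable (fun ω => quad W c + ∑ j, (E j).indicator (1 : Ω → ℝ) ω *
      (Matrix.toBilin' W c (d j) + Matrix.toBilin' W (d j) c)) P := (integrable_const _).add i₁
  refine ⟨i₀.add i₂, ?_⟩
  rw [integral_add i₀ i₂, integral_add (integrable_const _) i₁,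
    integral_finsetSum _ fun j _ => (hI _ (hE j)).mul_const _,
    integral_finsetSum _ fun j _ => i₂' j]
  have e₂ : ∀ j, ∫ ω, ∑ l, (E j ∩ E l).indicator (1 : Ω → ℝ) ω *
      Matrix.toBilin' W (d j) (d l) ∂P
      = ∑ l, μ j * μ l * Matrix.toBilin' W (d j) (d l) + s j * quad W (d j) := fun j => by
    rw [integral_finsetSum _ fun l _ => (hI _ ((hE j).inter (hE l))).mul_const _]
    simp only [integral_mul_const, hv _ ((hE j).inter (hE _)), h₂, add_mul,
      Finset.sum_add_distrib, ite_mul, zero_mul, Finset.sum_ite_eq, Finset.mem_univ, if_true,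
      quad_bilin]
  simp only [e₂, integral_mul_const, hv _ (hE _), h₁, Finset.sum_add_distrib, integral_const,
    probReal_univ, one_smul]
  ring

section Loss

variable {N : ℕ} {Ω : Type*} [MeasurableSpace Ω] {P : Measure Ω}
  {F : Set (SimpleGraph (Fin N))} {p : ℝ} {α : ℕ → Fin N × Fin N → Ω → Bool}

theorem mem_unionEdges {G : SimpleGraph (Fin N)} (hG : G ∈ F) {j i : Fin N} (h : G.Adj j i) :
    (j, i) ∈ unionEdges F := Set.mem_biUnion hG h

theorem BernoulliLoss.measurableSet_active (hα : BernoulliLoss P (unionEdges F) p α)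
    {ν : ℕ → SimpleGraph (Fin N)} {k : ℕ} (hG : ν k ∈ F) (e : Fin N × Fin N) :
    MeasurableSet {ω | e ∈ activeEdges ν α ω k} := by
  by_cases h : (ν k).Adj e.1 e.2
  · have : {ω | e ∈ activeEdges ν α ω k} = α k e ⁻¹' {true} := by
      ext ω; simp [activeEdges, edges, h]
    rw [this]
    exact hα.measurable k e (mem_unionEdges hG h) (measurableSet_singleton _)
  · have : {ω | e ∈ activeEdges ν α ω k} = ∅ := by
      ext ω; simp [activeEdges, edges, h]
    rw [this]
    exact MeasurableSet.empty

open Classical in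
theorem BernoulliLoss.prob_active (hα : BernoulliLoss P (unionEdges F) p α) (hp0 : 0 ≤ p)
    {ν : ℕ → SimpleGraph (Fin N)} {k : ℕ} (hG : ν k ∈ F) (j i : Fin N) :
    P.real {ω | (j, i) ∈ activeEdges ν α ω k} = p * if (ν k).Adj j i then 1 else 0 := by
  by_cases h : (ν k).Adj j i
  · have : {ω | (j, i) ∈ activeEdges ν α ω k} = {ω | α k (j, i) ω = true} := by
      ext ω; simp [activeEdges, edges, h]
    rw [this, measureReal_def, hα.prob_one k _ (mem_unionEdges hG h), ENNReal.toReal_ofReal hp0]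
    simp [h]
  · have : {ω | (j, i) ∈ activeEdges ν α ω k} = ∅ := by
      ext ω; simp [activeEdges, edges, h]
    rw [this]
    simp [h]

open Classical in
/-- The links into one agent are pairwise uncorrelated: the only link that may be correlated with
`(j, i)` is its reversal `(i, j)`, which leads to a different agent as there are no loops. -/
theorem BernoulliLoss.prob_active_inter (hα : BernoulliLoss P (unionEdges F) p α) (hp0 : 0 ≤ p)
    {ν : ℕ → SimpleGraph (Fin N)} {k : ℕ} (hG : ν k ∈ F) (i j l : Fin N) :
    P.real ({ω | (j, i) ∈ activeEdges ν α ω k} ∩ {ω | (l, i) ∈ activeEdges ν α ω k})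
      = (p * if (ν k).Adj j i then 1 else 0) * (p * if (ν k).Adj l i then 1 else 0)
        + if j = l then p * (1 - p) * (if (ν k).Adj j i then 1 else 0) else 0 := by
  by_cases hjl : j = l
  · subst hjl
    rw [Set.inter_self, hα.prob_active hp0 hG, if_pos rfl]
    split_ifs <;> simp
    ring
  rw [if_neg hjl, add_zero]
  by_cases h : (ν k).Adj j i ∧ (ν k).Adj l i
  · rw [← hα.prob_active hp0 hG, ← hα.prob_active hp0 hG]
    have hs : ∀ j, (ν k).Adj j i → {ω | (j, i) ∈ activeEdges ν α ω k} = α k (j, i) ⁻¹' {true} :=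
      fun j h => by ext ω; simp [activeEdges, edges, h]
    have hind := hα.indep_links k (j, i) (mem_unionEdges hG h.1) (l, i) (mem_unionEdges hG h.2)
      (by simp [Ne.symm hjl]) (by
        simp only [Prod.swap_prod_mk, ne_eq, Prod.mk.injEq, not_and]
        rintro rfl
        exact absurd h.2 ((ν k).loopless.irrefl _))
    rw [hs j h.1, hs l h.2, measureReal_def, hind.measure_inter_preimage_eq_mul _ _
      (measurableSet_singleton _) (measurableSet_singleton _), ENNReal.toReal_mul]
    rfl
  · have : {ω | (j, i) ∈ activeEdges ν α ω k} ∩ {ω | (l, i) ∈ activeEdges ν α ω k} = ∅ := by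
      ext ω
      simp only [activeEdges, edges, Set.mem_ofPred_eq, Set.mem_inter_iff, Set.mem_empty_iff_false]
      tauto
    rw [this]
    rcases not_and_or.1 h with h | h <;> simp [h]

open Classical in
/-- The mean of `y ↦ yᵀ (I ⊗ W) y` after one random step. The expected Laplacian gives the modal
matrices `M.bar p λ_r`; the variance `p (1 - p)` of the losses contributes a multiple of the
Dirichlet form of the graph. Both are diagonal in modal coordinates. -/
theorem BernoulliLoss.integral_blockQuad [IsProbabilityMeasure P]
    (hα : BernoulliLoss P (unionEdges F) p α) (hp0 : 0 ≤ p)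
    {ν : ℕ → SimpleGraph (Fin N)} {k : ℕ} (hG : ν k ∈ F)
    {U : Matrix (Fin N) (Fin N) ℝ} {lam : Fin N → ℝ} (hU : Diagonalises (ν k) U lam)
    {m n : ℕ} (W : Matrix (Fin m) (Fin m) ℝ) (M : DecompMatrix m n) (x : Fin N × Fin n → ℝ) :
    Integrable (fun ω => blockQuad W (M.full (activeEdges ν α ω k) (ν k) *ᵥ x)) P ∧
    ∫ ω, blockQuad W (M.full (activeEdges ν α ω k) (ν k) *ᵥ x) ∂P
      = ∑ r, (quad W (M.bar p (lam r) *ᵥ modal U (blk x) r)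
        + 2 * p * (1 - p) * lam r * quad W (M.c *ᵥ modal U (blk x) r)) := by
  have key := fun i => integral_quad_indicators (P := P) W
    (M.d *ᵥ blk x i + M.p *ᵥ ∑ j, laplacian (edges (ν k)) i j • blk x j)
    (fun j => M.c *ᵥ (blk x i - blk x j))
    (fun j => {ω | (j, i) ∈ activeEdges ν α ω k}) (fun j => hα.measurableSet_active hG _)
    (fun j => p * if (ν k).Adj j i then 1 else 0)
    (fun j => p * (1 - p) * if (ν k).Adj j i then 1 else 0)
    (fun j => hα.prob_active hp0 hG j i) (fun j l => hα.prob_active_inter hp0 hG i j l)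
  have hstep : ∀ ω i, blk (M.full (activeEdges ν α ω k) (ν k) *ᵥ x) i
      = M.d *ᵥ blk x i + M.p *ᵥ ∑ j, laplacian (edges (ν k)) i j • blk x j
        + ∑ j, {ω | (j, i) ∈ activeEdges ν α ω k}.indicator (1 : Ω → ℝ) ω
          • M.c *ᵥ (blk x i - blk x j) := fun ω i => by
    simp [blk_full_mulVec, Set.indicator_apply]
  simp only [blockQuad, hstep]
  refine ⟨integrable_finsetSum _ fun i _ => (key i).1, ?_⟩
  rw [integral_finsetSum _ fun i _ => (key i).1]
  have hmean : ∀ i, M.d *ᵥ blk x i + M.p *ᵥ ∑ j, laplacian (edges (ν k)) i j • blk x j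
      + ∑ j, (p * if (ν k).Adj j i then (1 : ℝ) else 0) • M.c *ᵥ (blk x i - blk x j)
      = M.d *ᵥ blk x i + (p • M.c + M.p) *ᵥ ∑ j, laplacian (edges (ν k)) i j • blk x j := fun i => by
    have h : ∑ j, (p * if (ν k).Adj j i then (1 : ℝ) else 0) • M.c *ᵥ (blk x i - blk x j)
        = p • M.c *ᵥ ∑ j, laplacian (edges (ν k)) i j • blk x j := by
      rw [sum_laplacian_smul (edges (ν k)), Matrix.mulVec_sum, Finset.smul_sum]
      simp only [mem_edges, Matrix.mulVec_smul, smul_smul]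
    rw [h, Matrix.add_mulVec, Matrix.smul_mulVec]
    abel
  have hmodal : ∀ r, modal U (fun i => M.d *ᵥ blk x i
      + (p • M.c + M.p) *ᵥ ∑ j, laplacian (edges (ν k)) i j • blk x j) r
      = M.bar p (lam r) *ᵥ modal U (blk x) r := fun r => by
    rw [modal_add, modal_mulVec, modal_mulVec, hU.modal_laplacian, DecompMatrix.bar]
    simp only [Matrix.add_mulVec, Matrix.smul_mulVec, Matrix.mulVec_smul]
  have hdir := hU.sum_adj_quad_sub (M.cᵀ * W * M.c) (blk x)
  simp only [quad_conj] at hdir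
  calc _ = ∑ i, (quad W (M.d *ᵥ blk x i
          + (p • M.c + M.p) *ᵥ ∑ j, laplacian (edges (ν k)) i j • blk x j)
        + ∑ j, p * (1 - p) * (if (ν k).Adj j i then 1 else 0)
          * quad W (M.c *ᵥ (blk x i - blk x j))) :=
        Finset.sum_congr rfl fun i _ => by rw [← hmean]; exact (key i).2
    _ = ∑ r, quad W (M.bar p (lam r) *ᵥ modal U (blk x) r)
        + p * (1 - p) * ∑ r, 2 * lam r * quad W (M.c *ᵥ modal U (blk x) r) := by
        rw [Finset.sum_add_distrib, ← hU.sum_quad, ← hdir]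
        simp only [hmodal, Finset.mul_sum, mul_assoc]
    _ = _ := by
        rw [Finset.mul_sum, ← Finset.sum_add_distrib]
        exact Finset.sum_congr rfl fun r _ => by ring

end Loss

/-! ### Modal costs and the linear matrix inequalities -/

section Modal

variable {m n z : ℕ}

/-- The value at `x` of the quadratic form on the left-hand side of the linear matrix inequalities
for the eigenvalue `lam`, with state matrix `M` and output matrix `K`. -/
def modeCost (Q : Matrix (Fin m) (Fin m) ℝ) (M : DecompMatrix m n) (K : DecompMatrix z n)
    (p lam : ℝ) (x : Fin n → ℝ) : ℝ :=
  quad Q (M.bar p lam *ᵥ x) + quad 1 (K.bar p lam *ᵥ x)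
    + lam * (2 * p * (1 - p) * (quad Q (M.c *ᵥ x) + quad 1 (K.c *ᵥ x)))

theorem quad_sub_lmi (Q : Matrix (Fin m) (Fin m) ℝ) (M : DecompMatrix m n) (K : DecompMatrix z n)
    (Z : Matrix (Fin n) (Fin n) ℝ) (p lam : ℝ) (x : Fin n → ℝ) :
    quad (Z - ((M.bar p lam)ᵀ * Q * M.bar p lam + (K.bar p lam)ᵀ * K.bar p lam
      + (2 * p * (1 - p) * lam) • (M.cᵀ * Q * M.c + K.cᵀ * K.c))) x
      = quad Z x - modeCost Q M K p lam x := by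
  simp only [quad_sub_weight, quad_add_weight, quad_smul_weight, quad_conj, quad_gram, modeCost]
  ring

theorem quad_sub_lmi_zero (Q : Matrix (Fin m) (Fin m) ℝ) (M : DecompMatrix m n)
    (K : DecompMatrix z n) (Z : Matrix (Fin n) (Fin n) ℝ) (p : ℝ) (x : Fin n → ℝ) :
    quad (Z - (M.dᵀ * Q * M.d + K.dᵀ * K.d)) x = quad Z x - modeCost Q M K p 0 x := by
  simp [quad_sub_weight, quad_add_weight, quad_conj, quad_gram, modeCost, DecompMatrix.bar]

theorem modeCost_nonneg {Q : Matrix (Fin m) (Fin m) ℝ} (hQ : Q.PosSemidef) (M : DecompMatrix m n)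
    (K : DecompMatrix z n) {p lam : ℝ} (hp0 : 0 ≤ p) (hp1 : p ≤ 1) (hlam : 0 ≤ lam)
    (x : Fin n → ℝ) : 0 ≤ modeCost Q M K p lam x := by
  have h1 : (1 : Matrix (Fin z) (Fin z) ℝ).PosSemidef := Matrix.PosSemidef.one
  have := sub_nonneg.2 hp1
  have := quad_nonneg hQ (M.c *ᵥ x)
  have := quad_nonneg h1 (K.c *ᵥ x)
  have := quad_nonneg hQ (M.bar p lam *ᵥ x)
  have := quad_nonneg h1 (K.bar p lam *ᵥ x)
  unfold modeCost
  positivity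

/-- The modal cost is convex in the eigenvalue, so it suffices to bound it at both ends of the
interval of admissible eigenvalues. -/
theorem modeCost_le_of_endpoints {Q : Matrix (Fin m) (Fin m) ℝ} (hQ : Q.PosSemidef)
    (M : DecompMatrix m n) (K : DecompMatrix z n) {p lo hi lam T : ℝ} {x : Fin n → ℝ}
    (h₁ : lo ≤ lam) (h₂ : lam ≤ hi) (hlo : modeCost Q M K p lo x ≤ T)
    (hhi : modeCost Q M K p hi x ≤ T) : modeCost Q M K p lam x ≤ T := by
  simp only [modeCost, DecompMatrix.bar, Matrix.add_mulVec _ (_ • _), Matrix.smul_mulVec] at *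
  exact quad_add_smul_le_of_endpoints hQ Matrix.PosSemidef.one _ _ _ _ _ _ h₁ h₂ hlo hhi

/-- A strict inequality `M ≺ Q`, with `R = Q - M`, leaves room for a factor `ρ < 1`: `M ≼ ρ Q`. -/
theorem exists_lt_one_sub_le {Q R : Matrix (Fin n) (Fin n) ℝ} (hQ : Q.PosDef) (hR : R.PosDef) :
    ∃ ρ : ℝ, 0 ≤ ρ ∧ ρ < 1 ∧ ∀ x, quad Q x - quad R x ≤ ρ * quad Q x := by
  obtain ⟨ε, hε, h⟩ := exists_pos_mul_quad_le hR Q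
  refine ⟨max (1 - ε) 0, le_max_right _ _, max_lt (by linarith) one_pos, fun x => ?_⟩
  have := mul_le_mul_of_nonneg_right (le_max_left (1 - ε) 0) (quad_nonneg hQ.posSemidef x)
  linarith [h x]

theorem modal_blk_single {N : ℕ} (U : Matrix (Fin N) (Fin N) ℝ) (i : Fin N) (a : Fin n)
    (r : Fin N) : modal U (blk (Pi.single (i, a) 1)) r = U i r • Pi.single a 1 := by
  have : ∀ j, blk (Pi.single (i, a) (1 : ℝ)) j = if j = i then Pi.single a 1 else 0 := by
    intro j
    ext b
    by_cases hj : j = i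
    · subst hj
      by_cases hb : b = a <;> simp [blk, hb]
    · simp [blk, hj]
  simp [modal, this]

end Modal

/-! ### One step of the random dynamics -/

section Step

variable {N : ℕ} {Ω : Type*} [MeasurableSpace Ω] {P : Measure Ω} [IsProbabilityMeasure P]
  {F : Set (SimpleGraph (Fin N))} {p : ℝ} {α : ℕ → Fin N × Fin N → Ω → Bool} {m n z : ℕ}

theorem BernoulliLoss.lintegral_step (hα : BernoulliLoss P (unionEdges F) p α) (hp0 : 0 ≤ p)
    {ν : ℕ → SimpleGraph (Fin N)} {k : ℕ} (hG : ν k ∈ F)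
    {U : Matrix (Fin N) (Fin N) ℝ} {lam : Fin N → ℝ} (hU : Diagonalises (ν k) U lam)
    {Q : Matrix (Fin m) (Fin m) ℝ} (hQ : Q.PosSemidef) (M : DecompMatrix m n)
    (K : DecompMatrix z n) (x : Fin N × Fin n → ℝ) :
    ∫⁻ ω, ENNReal.ofReal (blockQuad Q (M.full (activeEdges ν α ω k) (ν k) *ᵥ x)
        + normSq (K.full (activeEdges ν α ω k) (ν k) *ᵥ x)) ∂P
      = ENNReal.ofReal (∑ r, modeCost Q M K p (lam r) (modal U (blk x) r)) := by
  have hM := hα.integral_blockQuad hp0 hG hU Q M x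
  have hK := hα.integral_blockQuad hp0 hG hU 1 K x
  simp only [← blockQuad_one]
  rw [← ofReal_integral_eq_lintegral_ofReal (f := fun ω =>
    blockQuad Q (M.full (activeEdges ν α ω k) (ν k) *ᵥ x)
      + blockQuad 1 (K.full (activeEdges ν α ω k) (ν k) *ᵥ x)) (hM.1.add hK.1)]
  · rw [integral_add hM.1 hK.1, hM.2, hK.2, ← Finset.sum_add_distrib]
    congr 1
    refine Finset.sum_congr rfl fun r _ => ?_
    unfold modeCost
    ring
  · exact ae_of_all _ fun ω =>
      add_nonneg (blockQuad_nonneg hQ _) (blockQuad_nonneg Matrix.PosSemidef.one _)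

/-- The storage function `x ↦ xᵀ (I ⊗ Q) x` contracts in the mean, uniformly over the admissible
graphs, with a surplus that pays for the output energy. -/
theorem BernoulliLoss.exists_contraction (hα : BernoulliLoss P (unionEdges F) p α) (hp0 : 0 ≤ p)
    (hN : 1 ≤ N) {lo hi : ℝ} (hlo : 0 < lo) (hF : ∀ G ∈ F, EigenvaluesIn lo hi G)
    {Q : Matrix (Fin m) (Fin m) ℝ} (hQ : Q.PosDef) (M : DecompMatrix m m) (K : DecompMatrix z m)
    (hlmi : ∀ lam ∈ ({lo, hi} : Set ℝ),
      (Q - ((M.bar p lam)ᵀ * Q * M.bar p lam + (K.bar p lam)ᵀ * K.bar p lam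
        + (2 * p * (1 - p) * lam) • (M.cᵀ * Q * M.c + K.cᵀ * K.c))).PosDef)
    (hlmi₀ : (Q - (M.dᵀ * Q * M.d + K.dᵀ * K.d)).PosDef) :
    ∃ ρ : ℝ, 0 ≤ ρ ∧ ρ < 1 ∧ ∀ (ν : ℕ → SimpleGraph (Fin N)) (k : ℕ), ν k ∈ F → ∀ x,
      ∫⁻ ω, ENNReal.ofReal (blockQuad Q (M.full (activeEdges ν α ω k) (ν k) *ᵥ x)
        + normSq (K.full (activeEdges ν α ω k) (ν k) *ᵥ x)) ∂P
      ≤ ENNReal.ofReal ρ * ENNReal.ofReal (blockQuad Q x) := by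
  obtain ⟨ρ₁, h₁, h₁', b₁⟩ := exists_lt_one_sub_le hQ (hlmi lo (by simp))
  obtain ⟨ρ₂, h₂, h₂', b₂⟩ := exists_lt_one_sub_le hQ (hlmi hi (by simp))
  obtain ⟨ρ₃, h₃, h₃', b₃⟩ := exists_lt_one_sub_le hQ hlmi₀
  simp only [quad_sub_lmi, quad_sub_lmi_zero _ _ _ _ p, sub_sub_cancel] at b₁ b₂ b₃
  set ρ := max (max ρ₁ ρ₂) ρ₃ with hρ
  have hQ0 := fun x => quad_nonneg hQ.posSemidef x
  have c₁ : ∀ x, modeCost Q M K p lo x ≤ ρ * quad Q x := fun x =>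
    (b₁ x).trans (mul_le_mul_of_nonneg_right (by simp [hρ]) (hQ0 x))
  have c₂ : ∀ x, modeCost Q M K p hi x ≤ ρ * quad Q x := fun x =>
    (b₂ x).trans (mul_le_mul_of_nonneg_right (by simp [hρ]) (hQ0 x))
  have c₃ : ∀ x, modeCost Q M K p 0 x ≤ ρ * quad Q x := fun x =>
    (b₃ x).trans (mul_le_mul_of_nonneg_right (by simp [hρ]) (hQ0 x))
  have hρ0 : 0 ≤ ρ := h₃.trans (le_max_right _ _)
  refine ⟨ρ, hρ0, by simp [hρ, h₁', h₂', h₃'], fun ν k hG x => ?_⟩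
  obtain ⟨U, lam, hU, r₀, hr₀, hr⟩ := (hF _ hG).exists_diagonalises hN hlo
  rw [hα.lintegral_step hp0 hG hU hQ.posSemidef, ← ENNReal.ofReal_mul hρ0, blockQuad,
    ← hU.sum_quad, Finset.mul_sum]
  refine ENNReal.ofReal_le_ofReal (Finset.sum_le_sum fun r _ => ?_)
  by_cases h : r = r₀
  · rw [h, hr₀]
    exact c₃ _
  · exact modeCost_le_of_endpoints hQ.posSemidef M K (hr r h).1 (hr r h).2 (c₁ _) (c₂ _)

/-- The mean energy injected by an impulse, summed over all input channels: the consensus mode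
contributes at most `tr Z₂`, each of the other `N - 1` modes at most `tr Z₁`. -/
theorem BernoulliLoss.sum_impulse_le (hα : BernoulliLoss P (unionEdges F) p α) (hp0 : 0 ≤ p)
    (hp1 : p ≤ 1) (hN : 1 ≤ N) {lo hi : ℝ} (hlo : 0 < lo) (hF : ∀ G ∈ F, EigenvaluesIn lo hi G)
    {Q : Matrix (Fin m) (Fin m) ℝ} (hQ : Q.PosDef) (M : DecompMatrix m n) (K : DecompMatrix z n)
    {Z₁ Z₂ : Matrix (Fin n) (Fin n) ℝ}
    (hlmi : ∀ lam ∈ ({lo, hi} : Set ℝ),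
      (Z₁ - ((M.bar p lam)ᵀ * Q * M.bar p lam + (K.bar p lam)ᵀ * K.bar p lam
        + (2 * p * (1 - p) * lam) • (M.cᵀ * Q * M.c + K.cᵀ * K.c))).PosDef)
    (hlmi₀ : (Z₂ - (M.dᵀ * Q * M.d + K.dᵀ * K.d)).PosDef)
    (ν : ℕ → SimpleGraph (Fin N)) (k : ℕ) (hG : ν k ∈ F) :
    ∑ s : Fin N × Fin n, ∫⁻ ω, ENNReal.ofReal
        (blockQuad Q (M.full (activeEdges ν α ω k) (ν k) *ᵥ Pi.single s 1)
        + normSq (K.full (activeEdges ν α ω k) (ν k) *ᵥ Pi.single s 1)) ∂P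
      ≤ ENNReal.ofReal (Z₂.trace + ((N : ℝ) - 1) * Z₁.trace) := by
  have b₁ := fun x => quad_nonneg (hlmi lo (by simp)).posSemidef x
  have b₂ := fun x => quad_nonneg (hlmi hi (by simp)).posSemidef x
  have b₃ := fun x => quad_nonneg hlmi₀.posSemidef x
  simp only [quad_sub_lmi, quad_sub_lmi_zero _ _ _ _ p, sub_nonneg] at b₁ b₂ b₃
  obtain ⟨U, lam, hU, r₀, hr₀, hr⟩ := (hF _ hG).exists_diagonalises hN hlo
  simp only [hα.lintegral_step hp0 hG hU hQ.posSemidef]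
  have hlam : ∀ r, 0 ≤ lam r := fun r => by
    by_cases h : r = r₀
    · rw [h, hr₀]
    · exact hlo.le.trans (hr r h).1
  rw [← ENNReal.ofReal_sum_of_nonneg fun s _ => Finset.sum_nonneg fun r _ =>
    modeCost_nonneg hQ.posSemidef M K hp0 hp1 (hlam r) _]
  refine ENNReal.ofReal_le_ofReal ?_
  have hle : ∀ r x, modeCost Q M K p (lam r) x ≤ quad (if r = r₀ then Z₂ else Z₁) x := fun r x => by
    by_cases h : r = r₀
    · rw [if_pos h, h, hr₀]
      exact b₃ x
    · rw [if_neg h]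
      exact modeCost_le_of_endpoints hQ.posSemidef M K (hr r h).1 (hr r h).2 (b₁ _) (b₂ _)
  have hcol : ∀ r, ∑ i, U i r ^ 2 = 1 := fun r => by
    have h : (Uᵀ * U) r r = (1 : Matrix (Fin N) (Fin N) ℝ) r r := by
      rw [mul_eq_one_comm.1 hU.mul_transpose]
    simpa [Matrix.mul_apply, sq] using h
  calc _ ≤ ∑ s : Fin N × Fin n, ∑ r,
          quad (if r = r₀ then Z₂ else Z₁) (modal U (blk (Pi.single s 1)) r) :=
        Finset.sum_le_sum fun s _ => Finset.sum_le_sum fun r _ => hle r _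
    _ = ∑ r, (∑ i, U i r ^ 2) * (if r = r₀ then Z₂ else Z₁).trace := by
        rw [Finset.sum_comm]
        refine Finset.sum_congr rfl fun r _ => ?_
        simp only [Fintype.sum_prod_type, modal_blk_single, quad_smul, quad_single,
          Matrix.trace, Matrix.diag_apply, Finset.sum_mul_sum]
    _ = ∑ r, (if r = r₀ then Z₂ else Z₁).trace := by simp only [hcol, one_mul]
    _ = _ := by
        have : ∀ r, (if r = r₀ then Z₂ else Z₁).trace
            = Z₁.trace + if r = r₀ then Z₂.trace - Z₁.trace else 0 := fun r => by
          split_ifs <;> simp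
        simp only [this, Finset.sum_add_distrib, Finset.sum_const, Finset.card_univ,
          Fintype.card_fin, nsmul_eq_mul, Finset.sum_ite_eq', Finset.mem_univ, if_true]
        ring

end Step

/-! ### Propagation of mean bounds along the random dynamics -/

section Propagation

theorem lintegral_le_of_indepFun {Ω A B : Type*} [MeasurableSpace Ω] {P : Measure Ω}
    [IsProbabilityMeasure P] [MeasurableSpace A] [Countable A] [MeasurableSingletonClass A]
    [MeasurableSpace B] [Countable B] [MeasurableSingletonClass B] {H : Ω → A} {X : Ω → B}
    (hH : Measurable H) (hX : Measurable X) (hind : IndepFun H X P) (Φ : A → B → ℝ≥0∞)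
    (ψ : A → ℝ≥0∞) (h : ∀ a, ∫⁻ ω, Φ a (X ω) ∂P ≤ ψ a) :
    ∫⁻ ω, Φ (H ω) (X ω) ∂P ≤ ∫⁻ ω, ψ (H ω) ∂P := by
  have hΦ : Measurable (fun q : A × B => Φ q.1 q.2) := measurable_of_countable _
  have := Measure.isProbabilityMeasure_map (μ := P) hX.aemeasurable
  have := Measure.isProbabilityMeasure_map (μ := P) hH.aemeasurable
  calc ∫⁻ ω, Φ (H ω) (X ω) ∂P
      = ∫⁻ q, Φ q.1 q.2 ∂(P.map fun ω => (H ω, X ω)) := (lintegral_map hΦ (hH.prodMk hX)).symm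
    _ = ∫⁻ a, ∫⁻ b, Φ a b ∂P.map X ∂P.map H := by
        rw [(indepFun_iff_map_prod_eq_prod_map_map hH.aemeasurable hX.aemeasurable).1 hind,
          lintegral_prod _ hΦ.aemeasurable]
    _ = ∫⁻ a, ∫⁻ ω, Φ a (X ω) ∂P ∂P.map H :=
        lintegral_congr fun a => lintegral_map (measurable_of_countable _) hX
    _ ≤ ∫⁻ a, ψ a ∂P.map H := lintegral_mono h
    _ = ∫⁻ ω, ψ (H ω) ∂P := lintegral_map (measurable_of_countable _) hH

variable {N : ℕ} {Ω : Type*} {F : Set (SimpleGraph (Fin N))}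
  {p : ℝ} {α : ℕ → Fin N × Fin N → Ω → Bool} {n z : ℕ}

/-- The quantity `f` is a function of the losses on the links in `E₀` before time `k`. -/
def DependsOnPast {V : Type*} (E₀ : Set (Fin N × Fin N)) (α : ℕ → Fin N × Fin N → Ω → Bool)
    (k : ℕ) (f : Ω → V) : Prop :=
  ∃ g : (Finset.range k → E₀ → Bool) → V, ∀ ω, f ω = g fun i e => α i e ω

/-- The edges of `G` in `E₀` on which transmission succeeds according to `x`. -/
def survivors {E₀ : Set (Fin N × Fin N)} (G : SimpleGraph (Fin N)) (x : E₀ → Bool) :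
    Set (Fin N × Fin N) :=
  {e | e ∈ edges G ∧ ∃ h : e ∈ E₀, x ⟨e, h⟩ = true}

theorem activeEdges_eq_survivors {ν : ℕ → SimpleGraph (Fin N)} {k : ℕ} (hG : ν k ∈ F) (ω : Ω) :
    activeEdges ν α ω k = survivors (ν k) fun e : unionEdges F => α k e ω := by
  ext e
  have : e ∈ edges (ν k) → e ∈ unionEdges F := fun h => mem_unionEdges hG h
  simp only [activeEdges, survivors, Set.mem_ofPred_eq]
  constructor
  · exact fun h => ⟨h.1, this h.1, h.2⟩
  · exact fun ⟨h, _, h'⟩ => ⟨h, h'⟩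

theorem DependsOnPast.succ {V V' : Type*} {k : ℕ} {f : Ω → V}
    (hf : DependsOnPast (unionEdges F) α k f) {ν : ℕ → SimpleGraph (Fin N)} (hG : ν k ∈ F)
    (Ψ : V → Set (Fin N × Fin N) → V') :
    DependsOnPast (unionEdges F) α (k + 1) fun ω => Ψ (f ω) (activeEdges ν α ω k) := by
  obtain ⟨g, hg⟩ := hf
  refine ⟨fun h => Ψ (g fun i => h ⟨i, Finset.mem_range.2
    ((Finset.mem_range.1 i.2).trans k.lt_succ_self)⟩)
    (survivors (ν k) (h ⟨k, Finset.self_mem_range_succ k⟩)), fun ω => ?_⟩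
  simp only [hg, activeEdges_eq_survivors hG]

variable [MeasurableSpace Ω] {P : Measure Ω} [IsProbabilityMeasure P]

/-- A bound in the mean for deterministic `v` carries over to any `f` that is determined by the
past, since the losses at time `k` are independent of it. -/
theorem BernoulliLoss.lintegral_le (hα : BernoulliLoss P (unionEdges F) p α)
    {V : Type*} {k : ℕ} {f : Ω → V} (hf : DependsOnPast (unionEdges F) α k f)
    {ν : ℕ → SimpleGraph (Fin N)} (hG : ν k ∈ F) (Φ : V → Set (Fin N × Fin N) → ℝ≥0∞)
    (ψ : V → ℝ≥0∞) (h : ∀ v, ∫⁻ ω, Φ v (activeEdges ν α ω k) ∂P ≤ ψ v) :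
    ∫⁻ ω, Φ (f ω) (activeEdges ν α ω k) ∂P ≤ ∫⁻ ω, ψ (f ω) ∂P := by
  obtain ⟨g, hg⟩ := hf
  have hX : ∀ k, Measurable fun ω (e : unionEdges F) => α k e ω := fun k =>
    measurable_pi_lambda _ fun e => hα.measurable k e e.2
  have hind := hα.indep_time.indepFun_finset (Finset.range k) {k} (by simp) hX
  have hev : Measurable fun x : (({k} : Finset ℕ) → unionEdges F → Bool) =>
      x ⟨k, Finset.mem_singleton_self k⟩ := measurable_pi_apply _
  have hind' := hind.comp measurable_id hev
  simp only [hg, activeEdges_eq_survivors hG] at h ⊢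
  exact lintegral_le_of_indepFun
    (H := fun ω (i : Finset.range k) (e : unionEdges F) => α i e ω)
    (X := fun ω (e : unionEdges F) => α k e ω)
    (measurable_pi_lambda _ fun i => hX i) (hX k) hind'
    (fun a x => Φ (g a) (survivors (ν k) x)) (fun a => ψ (g a)) fun a => h (g a)

variable {Q : Matrix (Fin n) (Fin n) ℝ} {M : DecompMatrix n n} {K : DecompMatrix z n} {ρ : ℝ}
  {ν : ℕ → SimpleGraph (Fin N)} {ξ : ℕ → Ω → Fin N × Fin n → ℝ}

/-- The mean storage along a trajectory that is autonomous from time `1` on. -/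
theorem BernoulliLoss.storage_step (hα : BernoulliLoss P (unionEdges F) p α)
    (hQ : Q.PosSemidef)
    (hρ : ∀ k x, ∫⁻ ω, ENNReal.ofReal (blockQuad Q (M.full (activeEdges ν α ω k) (ν k) *ᵥ x)
        + normSq (K.full (activeEdges ν α ω k) (ν k) *ᵥ x)) ∂P
      ≤ ENNReal.ofReal ρ * ENNReal.ofReal (blockQuad Q x))
    (hν : ∀ k, ν k ∈ F) (h₁ : DependsOnPast (unionEdges F) α 1 (ξ 1))
    (hξ : ∀ k ω, ξ (k + 2) ω = M.full (activeEdges ν α ω (k + 1)) (ν (k + 1)) *ᵥ ξ (k + 1) ω)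
    (k : ℕ) :
    ∫⁻ ω, ENNReal.ofReal (blockQuad Q (ξ (k + 2) ω)) ∂P
      + ∫⁻ ω, ENNReal.ofReal
        (normSq (K.full (activeEdges ν α ω (k + 1)) (ν (k + 1)) *ᵥ ξ (k + 1) ω)) ∂P
      ≤ ENNReal.ofReal ρ * ∫⁻ ω, ENNReal.ofReal (blockQuad Q (ξ (k + 1) ω)) ∂P := by
  have hdep : ∀ k, DependsOnPast (unionEdges F) α (k + 1) (ξ (k + 1)) := fun k => by
    induction k with
    | zero => exact h₁
    | succ k ih =>
      rw [funext (hξ k)]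
      exact ih.succ (hν (k + 1)) fun x E => M.full E (ν (k + 1)) *ᵥ x
  refine (le_lintegral_add _ _).trans ?_
  rw [← lintegral_const_mul' _ _ ENNReal.ofReal_ne_top]
  simp only [hξ, ← ENNReal.ofReal_add (blockQuad_nonneg hQ _)
    ((blockQuad_nonneg Matrix.PosSemidef.one _).trans_eq (blockQuad_one _))]
  exact hα.lintegral_le (hdep k) (hν (k + 1))
    (fun x E => ENNReal.ofReal (blockQuad Q (M.full E (ν (k + 1)) *ᵥ x)
      + normSq (K.full E (ν (k + 1)) *ᵥ x)))
    (fun x => ENNReal.ofReal ρ * ENNReal.ofReal (blockQuad Q x)) (hρ (k + 1))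

theorem BernoulliLoss.tendsto_normSq (hα : BernoulliLoss P (unionEdges F) p α)
    (hQ : Q.PosDef) (hρ1 : ρ < 1)
    (hρ : ∀ k x, ∫⁻ ω, ENNReal.ofReal (blockQuad Q (M.full (activeEdges ν α ω k) (ν k) *ᵥ x)
        + normSq (K.full (activeEdges ν α ω k) (ν k) *ᵥ x)) ∂P
      ≤ ENNReal.ofReal ρ * ENNReal.ofReal (blockQuad Q x))
    (hν : ∀ k, ν k ∈ F) (h₁ : DependsOnPast (unionEdges F) α 1 (ξ 1))
    (hξ : ∀ k ω, ξ (k + 2) ω = M.full (activeEdges ν α ω (k + 1)) (ν (k + 1)) *ᵥ ξ (k + 1) ω)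
    (hfin : ∫⁻ ω, ENNReal.ofReal (blockQuad Q (ξ 1 ω)) ∂P ≠ ∞) :
    Tendsto (fun k => ∫⁻ ω, ENNReal.ofReal (normSq (ξ k ω)) ∂P) atTop (𝓝 0) := by
  obtain ⟨ε, hε, hQε⟩ := exists_pos_mul_quad_le hQ 1
  have hgeom : ∀ k, ∫⁻ ω, ENNReal.ofReal (blockQuad Q (ξ (k + 1) ω)) ∂P
      ≤ ENNReal.ofReal ρ ^ k * ∫⁻ ω, ENNReal.ofReal (blockQuad Q (ξ 1 ω)) ∂P := fun k => by
    induction k with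
    | zero => simp
    | succ k ih =>
      calc _ ≤ _ := le_self_add.trans (hα.storage_step hQ.posSemidef hρ hν h₁ hξ k)
        _ ≤ _ := mul_le_mul_right ih _
        _ = _ := by rw [pow_succ', mul_assoc]
  have hnorm : ∀ x : Fin N × Fin n → ℝ,
      ENNReal.ofReal (normSq x) ≤ ENNReal.ofReal ε⁻¹ * ENNReal.ofReal (blockQuad Q x) := fun x => by
    rw [← ENNReal.ofReal_mul (inv_pos.2 hε).le]
    refine ENNReal.ofReal_le_ofReal ?_
    rw [inv_mul_eq_div, le_div_iff₀ hε, ← blockQuad_one, mul_comm, blockQuad, Finset.mul_sum]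
    exact Finset.sum_le_sum fun i _ => hQε _
  rw [← tendsto_add_atTop_iff_nat 1]
  refine tendsto_of_tendsto_of_tendsto_of_le_of_le tendsto_const_nhds (h := fun k =>
    ENNReal.ofReal ε⁻¹ * (ENNReal.ofReal ρ ^ k
      * ∫⁻ ω, ENNReal.ofReal (blockQuad Q (ξ 1 ω)) ∂P)) ?_ (fun _ => zero_le) fun k => ?_
  · have h := ENNReal.tendsto_pow_atTop_nhds_zero_of_lt_one
      (show ENNReal.ofReal ρ < 1 by rwa [ENNReal.ofReal_lt_one])
    simpa using ENNReal.Tendsto.const_mul (ENNReal.Tendsto.mul_const h (Or.inr hfin))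
      (Or.inr ENNReal.ofReal_ne_top)
  · calc _ ≤ ∫⁻ ω, ENNReal.ofReal ε⁻¹ * ENNReal.ofReal (blockQuad Q (ξ (k + 1) ω)) ∂P :=
          lintegral_mono fun ω => hnorm _
      _ = _ := lintegral_const_mul' _ _ ENNReal.ofReal_ne_top
      _ ≤ _ := mul_le_mul_right (hgeom k) _

/-- The storage at time `1` bounds the total mean output energy from then on. -/
theorem BernoulliLoss.tsum_normSq_le (hα : BernoulliLoss P (unionEdges F) p α)
    (hQ : Q.PosSemidef) (hρ1 : ρ < 1)
    (hρ : ∀ k x, ∫⁻ ω, ENNReal.ofReal (blockQuad Q (M.full (activeEdges ν α ω k) (ν k) *ᵥ x)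
        + normSq (K.full (activeEdges ν α ω k) (ν k) *ᵥ x)) ∂P
      ≤ ENNReal.ofReal ρ * ENNReal.ofReal (blockQuad Q x))
    (hν : ∀ k, ν k ∈ F) (h₁ : DependsOnPast (unionEdges F) α 1 (ξ 1))
    (hξ : ∀ k ω, ξ (k + 2) ω = M.full (activeEdges ν α ω (k + 1)) (ν (k + 1)) *ᵥ ξ (k + 1) ω) :
    ∑' k, ∫⁻ ω, ENNReal.ofReal
        (normSq (K.full (activeEdges ν α ω (k + 1)) (ν (k + 1)) *ᵥ ξ (k + 1) ω)) ∂P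
      ≤ ∫⁻ ω, ENNReal.ofReal (blockQuad Q (ξ 1 ω)) ∂P := by
  refine ENNReal.tsum_le_of_sum_range_le fun j => ?_
  -- Keep the storage at time `j + 1`, so that the partial sums telescope.
  refine le_trans (b := ∫⁻ ω, ENNReal.ofReal (blockQuad Q (ξ (j + 1) ω)) ∂P + _) le_add_self ?_
  induction j with
  | zero => simp
  | succ j ih =>
    refine le_trans ?_ ih
    rw [Finset.sum_range_succ, add_comm (Finset.sum _ _), ← add_assoc]
    gcongr
    refine (hα.storage_step hQ hρ hν h₁ hξ j).trans ?_
    exact mul_le_of_le_one_left zero_le (ENNReal.ofReal_le_one.2 hρ1.le)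

end Propagation

end SwitchedMAS

/-! ### Mean-square stability and the `H₂`-norm -/

theorem theorem2 {N nx nw nz : ℕ} (hN : 1 ≤ N)
    (S : SwitchedMAS.System nx nw nz)
    (F : Set (SimpleGraph (Fin N))) (lo hi : ℝ) (hlo : 0 < lo) (hlohi : lo ≤ hi)
    (hF : ∀ G ∈ F, SwitchedMAS.EigenvaluesIn lo hi G)
    {Ω : Type*} [MeasurableSpace Ω] (P : Measure Ω) [IsProbabilityMeasure P]
    (p : ℝ) (hp0 : 0 ≤ p) (hp1 : p ≤ 1)
    (α : ℕ → Fin N × Fin N → Ω → Bool)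
    (hα : SwitchedMAS.BernoulliLoss P (SwitchedMAS.unionEdges F) p α)
    (β γ : ℝ)
    (hLMI : ∃ (Q : Matrix (Fin nx) (Fin nx) ℝ) (Z₁ Z₂ : Matrix (Fin nw) (Fin nw) ℝ),
      Q.PosDef ∧ Z₁.IsSymm ∧ Z₂.IsSymm ∧ Z₁.trace < γ ^ 2 ∧ Z₂.trace < β ^ 2 ∧
      (∀ lam ∈ ({lo, hi} : Set ℝ),
        (Q - ((S.A.bar p lam)ᵀ * Q * S.A.bar p lam + (S.C.bar p lam)ᵀ * S.C.bar p lam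
          + (2 * p * (1 - p) * lam) • (S.A.cᵀ * Q * S.A.c + S.C.cᵀ * S.C.c))).PosDef ∧
        (Z₁ - ((S.B.bar p lam)ᵀ * Q * S.B.bar p lam + (S.D.bar p lam)ᵀ * S.D.bar p lam
          + (2 * p * (1 - p) * lam) • (S.B.cᵀ * Q * S.B.c + S.D.cᵀ * S.D.c))).PosDef) ∧
      (Q - (S.A.dᵀ * Q * S.A.d + S.C.dᵀ * S.C.d)).PosDef ∧
      (Z₂ - (S.B.dᵀ * Q * S.B.d + S.D.dᵀ * S.D.d)).PosDef) :
    S.MeanSquareStable F P α ∧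
      S.h2NormSq F P α < ENNReal.ofReal (β ^ 2 + ((N : ℝ) - 1) * γ ^ 2) := by
  open SwitchedMAS in
  obtain ⟨Q, Z₁, Z₂, hQ, -, -, hZ₁, hZ₂, hlmi, hlmi₀, hlmi₀'⟩ := hLMI
  obtain ⟨ρ, hρ0, hρ1, hρ⟩ := hα.exists_contraction hp0 hN hlo hF hQ S.A S.C
    (fun lam h => (hlmi lam h).1) hlmi₀
  refine ⟨fun ξ₀ ν hν => ⟨?_, fun π₀ => ?_⟩, ?_⟩
  · refine hα.tendsto_normSq hQ hρ1 (fun k => hρ ν k (hν k)) hν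
      (ξ := fun k ω => S.state ν (activeEdges ν α ω) 0 ξ₀ k) ?_ (fun k ω => ?_) ?_
    · exact DependsOnPast.succ (f := fun _ => ξ₀) ⟨fun _ => ξ₀, fun _ => rfl⟩ (hν 0)
        fun x E => S.A.full E (ν 0) *ᵥ x + S.B.full E (ν 0) *ᵥ 0
    · simp [System.state]
    · refine ne_top_of_le_ne_top (ENNReal.mul_ne_top ENNReal.ofReal_ne_top ENNReal.ofReal_ne_top)
        (le_trans (lintegral_mono fun ω => ENNReal.ofReal_le_ofReal ?_) (hρ ν 0 (hν 0) ξ₀))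
      simp only [System.state, Pi.zero_apply, Matrix.mulVec_zero, add_zero, ← blockQuad_one]
      exact le_add_of_nonneg_right (blockQuad_nonneg Matrix.PosSemidef.one _)
  · have := Fintype.ofFinite (lossyFamily F)
    simp only [tsum_fintype]
    have hz : ∑ _E : lossyFamily F, (0 : ℝ≥0∞) = 0 := Finset.sum_const_zero
    rw [← hz]
    refine tendsto_finsetSum _ fun E _ => ?_
    rw [← mul_zero (π₀ E)]
    refine ENNReal.Tendsto.const_mul ?_ (Or.inr (π₀.apply_ne_top E))
    -- With a deterministic edge set at time `0`, the state at time `1` is deterministic.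
    refine hα.tendsto_normSq hQ hρ1 (fun k => hρ ν k (hν k)) hν (ξ := fun k ω =>
      S.state ν (Function.update (activeEdges ν α ω) 0 (E : Set (Fin N × Fin N))) 0 ξ₀ k)
      ?_ (fun k ω => ?_) ?_
    · exact ⟨fun _ => S.A.full E (ν 0) *ᵥ ξ₀ + S.B.full E (ν 0) *ᵥ 0,
        fun ω => by simp [System.state]⟩
    · simp [System.state]
    · simp [System.state]
  · have hZ₂0 : 0 ≤ Z₂.trace := Finset.sum_nonneg fun a _ => by
      have h := quad_nonneg hlmi₀'.posSemidef (Pi.single a 1)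
      rw [quad_sub_lmi_zero Q S.B S.D Z₂ p, quad_single] at h
      exact (modeCost_nonneg hQ.posSemidef S.B S.D hp0 hp1 le_rfl _).trans (sub_nonneg.1 h)
    have hN' : (0 : ℝ) ≤ (N : ℝ) - 1 := sub_nonneg.2 (by exact_mod_cast hN)
    refine lt_of_le_of_lt (b := ENNReal.ofReal (Z₂.trace + ((N : ℝ) - 1) * Z₁.trace))
      (iSup₂_le fun ν hν => ?_) ?_
    · refine le_trans (Finset.sum_le_sum fun s _ => ?_) (hα.sum_impulse_le hp0 hp1 hN hlo hF hQ
        S.B S.D (fun lam h => (hlmi lam h).2) hlmi₀' ν 0 (hν 0))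
      have htail := hα.tsum_normSq_le hQ.posSemidef hρ1 (fun k => hρ ν k (hν k)) hν
        (ξ := fun k ω => S.state ν (activeEdges ν α ω) (impulse s) 0 k)
        (DependsOnPast.succ (f := fun _ => (0 : Fin N × Fin nx → ℝ)) ⟨fun _ => 0, fun _ => rfl⟩
          (hν 0) fun x E => S.A.full E (ν 0) *ᵥ x + S.B.full E (ν 0) *ᵥ impulse s 0)
        (fun k ω => by simp [System.state, impulse])
      rw [tsum_eq_zero_add' ENNReal.summable]
      have h0 : ∀ ω, S.output ν (activeEdges ν α ω) (impulse s) 0 0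
          = S.D.full (activeEdges ν α ω 0) (ν 0) *ᵥ Pi.single s 1 := fun ω => by
        simp [System.output, System.state, impulse]
      have h1 : ∀ k ω, S.output ν (activeEdges ν α ω) (impulse s) 0 (k + 1)
          = S.C.full (activeEdges ν α ω (k + 1)) (ν (k + 1))
            *ᵥ S.state ν (activeEdges ν α ω) (impulse s) 0 (k + 1) := fun k ω => by
        simp [System.output, impulse]
      have h2 : ∀ ω, S.state ν (activeEdges ν α ω) (impulse s) 0 1
          = S.B.full (activeEdges ν α ω 0) (ν 0) *ᵥ Pi.single s 1 := fun ω => by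
        simp [System.state, impulse]
      simp only [h0, h1]
      simp only [h2] at htail
      refine (add_le_add_right htail _).trans ?_
      rw [add_comm]
      refine (le_lintegral_add _ _).trans (lintegral_mono fun ω => ?_)
      rw [← ENNReal.ofReal_add (blockQuad_nonneg hQ.posSemidef _)
        ((blockQuad_nonneg Matrix.PosSemidef.one _).trans_eq (blockQuad_one _))]
    -- `0 < β ^ 2` makes the bound positive, so that `ENNReal.ofReal` preserves strictness.
    · have hβ : 0 < β ^ 2 := hZ₂0.trans_lt hZ₂
      rw [ENNReal.ofReal_lt_ofReal_iff (by positivity)]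
      exact add_lt_add_of_lt_of_le hZ₂ (mul_le_mul_of_nonneg_left hZ₁.le hN')
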